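/- Let $N=\{1,\dots,n\}$ with $n\ge 1$ be a set of agents and let $M=\{g_1,\dots,g_m\}$ with $m\ge 0$ be a set of indivisible goods. Each agent $i$ has an additive valuation function $v_i:2^M\to\mathbb{R}$, i.e. $v_i(\{g\})\ge 0$ for every $g\in M$ and $v_i(S\cup T)=v_i(S)+v_i(T)$ for all disjoint $S,T\subseteq M$; ties between goods and goods of value zero are allowed. The Round-Robin mechanism takes as input a bid profile $\mathbf{b}=(b_1,\dots,b_n)$ of bid vectors $b_i\in\mathbb{R}_{\ge 0}^{m}$ and runs $\lceil m/n\rceil$ rounds. In each round the agents $1,2,\dots,n$ take turns in this order, and, in her turn, agent $i$ receives the still unallocated good with the highest bid according to $b_i$, where ties are broken in favor of the good of lowest index (she receives nothing if all the goods have been allocated). Let $A_i(\mathbf{b})$ be the set of goods that agent $i$ has received in the end. A bid profile $\mathbf{b}$ is a pure Nash equilibrium if for every agent $i$ and every bid vector $b_i'\in\mathbb{R}_{\ge 0}^{m}$ we have $v_i(A_i(b_i',\mathbf{b}_{-i}))\le v_i(A_i(\mathbf{b}))$, where $(b_i',\mathbf{b}_{-i})$ denotes $\mathbf{b}$ with $b_i$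 replaced by $b_i'$. **Theorem.** For every such instance $(N,M,(v_1,\dots,v_n))$, the Round-Robin mechanism has at least one pure Nash equilibrium. -/

import Mathlib

open scoped NNReal

namespace FairDivision

/-- A valuation function over the goods `Fin m` : every single good has a non-negative value,
and the value of a union of two disjoint sets of goods is the sum of their values.
Ties between goods and goods of value zero are allowed. -/
structure AdditiveValuation (m : ℕ) where
  val : Finset (Fin m) → ℝ
  nonneg : ∀ g : Fin m, 0 ≤ val {g}
  additive : ∀ S T : Finset (Fin m), Disjoint S T → val (S ∪ T) = val S + val T

/-- An allocation of all the goods `Fin m` to the agents `Fin n`: the (possibly empty) bundles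
are pairwise disjoint and together contain every good. -/
structure Allocation (n m : ℕ) where
  bundle : Fin n → Finset (Fin m)
  disjoint : ∀ i j : Fin n, i ≠ j → Disjoint (bundle i) (bundle j)
  cover : ∀ g : Fin m, ∃ i : Fin n, g ∈ bundle i

/-- A bid vector declares a non-negative value for every good. -/
abbrev Bid (m : ℕ) : Type := Fin m → ℝ≥0

/-- A bid profile has one bid vector for each agent. -/
abbrev BidProfile (n m : ℕ) : Type := Fin n → Bid m

/-- An allocation mechanism (without payments) maps bid profiles to allocations. -/
abbrev Mechanism (n m : ℕ) : Type := BidProfile n m → Allocation n m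

/-- `b i` is a best response of agent `i`, with true valuation `vi`, to the bids of the others:
no unilateral change of the bid of `i` gives her a bundle of higher true value. -/
def IsBestResponse {n m : ℕ} (mech : Mechanism n m) (vi : AdditiveValuation m)
    (b : BidProfile n m) (i : Fin n) : Prop :=
  ∀ b' : Bid m, vi.val ((mech (Function.update b i b')).bundle i) ≤ vi.val ((mech b).bundle i)

/-- `b` is a pure Nash equilibrium of the mechanism with respect to the true valuations `v`. -/
def IsPNE {n m : ℕ} (mech : Mechanism n m) (v : Fin n → AdditiveValuation m)
    (b : BidProfile n m) : Prop :=
  ∀ i : Fin n, IsBestResponse mech (v i) b i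

namespace RoundRobin

/-- The available goods of highest bid. -/
noncomputable def maximizers {m : ℕ} (bi : Bid m) (S : Finset (Fin m)) : Finset (Fin m) :=
  S.filter (fun g => ∀ h ∈ S, bi h ≤ bi g)

theorem maximizers_nonempty {m : ℕ} (bi : Bid m) (S : Finset (Fin m)) (hS : S.Nonempty) :
    (maximizers bi S).Nonempty := by
  obtain ⟨g, hg, hmax⟩ := S.exists_max_image bi hS
  exact ⟨g, Finset.mem_filter.mpr ⟨hg, hmax⟩⟩

/-- The available good of highest bid; among several ones, the one of lowest index. -/
noncomputable def favorite {m : ℕ} (bi : Bid m) (S : Finset (Fin m)) (hS : S.Nonempty) : Fin m :=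
  (maximizers bi S).min' (maximizers_nonempty bi S hS)

theorem favorite_mem {m : ℕ} (bi : Bid m) (S : Finset (Fin m)) (hS : S.Nonempty) :
    favorite bi S hS ∈ S :=
  (Finset.mem_filter.mp ((maximizers bi S).min'_mem (maximizers_nonempty bi S hS))).1

/-- The set of available goods, and the bundles assigned so far. -/
structure State (n m : ℕ) where
  avail : Finset (Fin m)
  bundle : Fin n → Finset (Fin m)

/-- At the start all the goods are available and all the bundles are empty. -/
def init (n m : ℕ) : State n m := ⟨Finset.univ, fun _ => ∅⟩

/-- The turn of agent `i`: she receives her favorite available good according to her bid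
(nothing happens if no good is left, as in the last turns of an incomplete last round). -/
noncomputable def turn {n m : ℕ} (b : BidProfile n m) (s : State n m) (i : Fin n) : State n m :=
  if hS : s.avail.Nonempty then
    { avail := s.avail.erase (favorite (b i) s.avail hS)
      bundle := Function.update s.bundle i (insert (favorite (b i) s.avail hS) (s.bundle i)) }
  else s

/-- One round: the agents take their turns in the order `0, 1, …, n - 1`. -/
noncomputable def round {n m : ℕ} (b : BidProfile n m) (s : State n m) : State n m :=
  (List.finRange n).foldl (turn b) s

/-- The state after `⌈m / n⌉` rounds. -/
noncomputable def final {n m : ℕ} (b : BidProfile n m) : State n m :=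
  (round b)^[⌈(m : ℚ) / (n : ℚ)⌉₊] (init n m)

/-- The goods are partitioned into the available ones and the bundles. -/
def Consistent {n m : ℕ} (s : State n m) : Prop :=
  (∀ i j : Fin n, i ≠ j → Disjoint (s.bundle i) (s.bundle j)) ∧
  (∀ i : Fin n, Disjoint s.avail (s.bundle i)) ∧
  (∀ g : Fin m, g ∈ s.avail ∨ ∃ i : Fin n, g ∈ s.bundle i)

theorem turn_consistent {n m : ℕ} (b : BidProfile n m) (s : State n m) (i : Fin n)
    (hs : Consistent s) : Consistent (turn b s i) := by
  unfold turn
  split_ifs with hS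
  · obtain ⟨h1, h2, h3⟩ := hs
    have hf := favorite_mem (b i) s.avail hS
    generalize favorite (b i) s.avail hS = f at hf
    have hfn : ∀ j, f ∉ s.bundle j := fun j => Finset.disjoint_left.mp (h2 j) hf
    refine ⟨?_, ?_, ?_⟩
    · intro j k hjk
      by_cases hj : j = i
      · subst hj
        simp [Function.update_of_ne hjk.symm, Finset.disjoint_insert_left, hfn, h1 _ _ hjk]
      · by_cases hk : k = i
        · subst hk
          simp [Function.update_of_ne hj, Finset.disjoint_insert_right, hfn, h1 _ _ hjk]
        · simp [Function.update_of_ne hj, Function.update_of_ne hk, h1 _ _ hjk]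
    · intro j
      by_cases hj : j = i
      · subst hj
        simp only [Function.update_self, Finset.disjoint_insert_right]
        exact ⟨by simp, (h2 _).mono_left (Finset.erase_subset _ _)⟩
      · simp only [Function.update_of_ne hj]
        exact (h2 _).mono_left (Finset.erase_subset _ _)
    · intro g
      by_cases hg : g = f
      · exact Or.inr ⟨i, by simp [hg]⟩
      · rcases h3 g with h | ⟨j, h⟩
        · exact Or.inl (Finset.mem_erase.mpr ⟨hg, h⟩)
        · refine Or.inr ⟨j, ?_⟩
          by_cases hj : j = i
          · subst hj
            simp [h]
          · simpa [Function.update_of_ne hj] using h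
  · exact hs

theorem turn_card {n m : ℕ} (b : BidProfile n m) (s : State n m) (i : Fin n) :
    (turn b s i).avail.card = s.avail.card - 1 := by
  unfold turn
  split_ifs with hS
  · exact Finset.card_erase_of_mem (favorite_mem (b i) s.avail hS)
  · simp [Finset.not_nonempty_iff_eq_empty.mp hS]

theorem foldl_turn {n m : ℕ} (b : BidProfile n m) (l : List (Fin n)) (s : State n m)
    (hs : Consistent s) : Consistent (l.foldl (turn b) s) ∧
      (l.foldl (turn b) s).avail.card = s.avail.card - l.length := by
  induction l generalizing s with
  | nil => exact ⟨hs, by simp⟩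
  | cons i l ih =>
    obtain ⟨h1, h2⟩ := ih (turn b s i) (turn_consistent b s i hs)
    refine ⟨h1, ?_⟩
    rw [List.foldl_cons, h2, turn_card, List.length_cons]
    omega

theorem iterate_round {n m : ℕ} (b : BidProfile n m) (k : ℕ) (s : State n m)
    (hs : Consistent s) : Consistent ((round b)^[k] s) ∧
      ((round b)^[k] s).avail.card = s.avail.card - k * n := by
  induction k generalizing s with
  | zero => exact ⟨hs, by simp⟩
  | succ k ih =>
    obtain ⟨h1, h2⟩ := foldl_turn b (List.finRange n) s hs
    obtain ⟨h3, h4⟩ := ih (round b s) h1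
    refine ⟨h3, ?_⟩
    rw [Function.iterate_succ_apply, h4, round, h2, List.length_finRange, Nat.succ_mul]
    omega

theorem final_consistent {n m : ℕ} (b : BidProfile n m) : Consistent (final b) :=
  (iterate_round b _ (init n m) ⟨by simp [init], by simp [init], by simp [init]⟩).1

theorem final_avail {n m : ℕ} (hn : 0 < n) (b : BidProfile n m) : (final b).avail = ∅ := by
  have h := (iterate_round b ⌈(m : ℚ) / (n : ℚ)⌉₊ (init n m)
    ⟨by simp [init], by simp [init], by simp [init]⟩).2
  have hk : m ≤ ⌈(m : ℚ) / (n : ℚ)⌉₊ * n := by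
    have h0 : (0 : ℚ) < n := by exact_mod_cast hn
    have h1 := (div_le_iff₀ h0).mp (Nat.le_ceil ((m : ℚ) / (n : ℚ)))
    exact_mod_cast h1
  rw [← Finset.card_eq_zero, final, h]
  simp only [init, Finset.card_univ, Fintype.card_fin]
  omega

end RoundRobin

/-- The Round-Robin mechanism for `n ≥ 1` agents. -/
noncomputable def roundRobin {n m : ℕ} (hn : 0 < n) : Mechanism n m := fun b =>
  { bundle := (RoundRobin.final b).bundle
    disjoint := (RoundRobin.final_consistent b).1
    cover := fun g => by
      rcases (RoundRobin.final_consistent b).2.2 g with h | h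
      · rw [RoundRobin.final_avail hn b] at h
        exact absurd h (Finset.notMem_empty g)
      · exact h }

end FairDivision

/-!
Any run of a picking sequence orders the goods by the time at which they are picked; let `σ` be
this order when everybody bids truthfully. In the equilibrium all agents bid according to `σ`, so
that turn `t` again yields `σ t`. If agent `i` deviates, the run has some order `σ ∘ τ`. A turn `t`
of another agent takes the first remaining good of `σ`, whence `τ t ≤ t`. Let `W t` be the largest
value that agent `i` has for a good among `σ t, σ (t + 1), …`. It is antitone in `t`, so the other
agents together do not lose `W`-value when `i` deviates, and hence `i` does not gain any. As `W t`
bounds the value of `σ t`, with equality at the turns of `i`, her true value does not grow either.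
-/

namespace FairDivision

open Finset

theorem perm_apply_le_of_forall_le {α : Type*} [LinearOrder α] [LocallyFiniteOrderTop α]
    (τ : Equiv.Perm α) {t : α} (h : ∀ p, t ≤ p → τ t ≤ τ p) : τ t ≤ t := by
  by_contra! hlt
  have hle : #(Ici t) ≤ #(Ici (τ t)) :=
    card_le_card_of_injOn τ (fun p hp => by simpa using h p (by simpa using hp))
      τ.injective.injOn
  have hss : Ici (τ t) ⊂ Ici t := Ici_ssubset_Ici.mpr hlt
  exact (card_lt_card hss).not_ge hle

theorem sum_comp_perm_le_sum {α β : Type*} [Finite α] [Preorder α] [AddCommMonoid β]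
    [LinearOrder β] [IsOrderedCancelAddMonoid β] (τ : Equiv.Perm α) (T : Finset α) (w : α → β)
    (hτ : ∀ t ∉ T, τ t ≤ t) (hw : ∀ t ∈ T, ∀ p, t ≤ p → w p ≤ w t) :
    ∑ t ∈ T, w (τ t) ≤ ∑ t ∈ T, w t := by
  classical
  have := Fintype.ofFinite α
  let W : α → β := fun t => (univ.filter (t ≤ ·)).sup' ⟨t, by simp⟩ w
  have hwW : ∀ t, w t ≤ W t := fun t => le_sup' w (by simp)
  have hW_anti : Antitone W := fun _ _ hst =>
    sup'_mono w (monotone_filter_right _ fun _ _ => hst.trans) _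
  have hW_eq : ∀ t ∈ T, W t = w t := fun t ht =>
    (sup'_le _ _ fun p hp => hw t ht p (mem_filter.mp hp).2).antisymm (hwW t)
  refine le_of_add_le_add_right (a := ∑ t ∈ Tᶜ, W t) ?_
  calc ∑ t ∈ T, w (τ t) + ∑ t ∈ Tᶜ, W t
      ≤ ∑ t ∈ T, W (τ t) + ∑ t ∈ Tᶜ, W (τ t) :=
        add_le_add (sum_le_sum fun t _ => hwW _)
          (sum_le_sum fun t ht => hW_anti (hτ t (mem_compl.mp ht)))
    _ = ∑ t ∈ T, W t + ∑ t ∈ Tᶜ, W t := by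
        rw [sum_add_sum_compl, sum_add_sum_compl, Equiv.sum_comp]
    _ = ∑ t ∈ T, w t + ∑ t ∈ Tᶜ, W t := by rw [sum_congr rfl hW_eq]

theorem AdditiveValuation.val_empty {m : ℕ} (v : AdditiveValuation m) : v.val ∅ = 0 := by
  simpa using v.additive ∅ ∅ (disjoint_empty_left ∅)

theorem AdditiveValuation.val_eq_sum {m : ℕ} (v : AdditiveValuation m) (S : Finset (Fin m)) :
    v.val S = ∑ g ∈ S, v.val {g} := by
  induction S using Finset.induction_on with
  | empty => rw [v.val_empty, sum_empty]
  | insert g S hg ih =>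
    rw [sum_insert hg, ← ih, insert_eq, v.additive _ _ (disjoint_singleton_left.mpr hg)]

namespace RoundRobin

theorem le_favorite {m : ℕ} (bi : Bid m) {S : Finset (Fin m)} (hS : S.Nonempty) {g : Fin m}
    (hg : g ∈ S) : bi g ≤ bi (favorite bi S hS) :=
  (mem_filter.mp ((maximizers bi S).min'_mem (maximizers_nonempty bi S hS))).2 g hg

theorem init_consistent (n m : ℕ) : Consistent (init n m) := by
  simp [Consistent, init]

section PickingSequence

variable {n m : ℕ} (b : BidProfile n m) (a : ℕ → Fin n)

/-- The state after `t` turns of the picking sequence `a`, in which turn `u = 0, 1, …` belongs to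
agent `a u`. -/
noncomputable def runTurns (t : ℕ) : State n m :=
  ((List.range t).map a).foldl (turn b) (init n m)

theorem runTurns_succ (t : ℕ) : runTurns b a (t + 1) = turn b (runTurns b a t) (a t) := by
  simp [runTurns, List.range_succ]

theorem runTurns_consistent (t : ℕ) : Consistent (runTurns b a t) :=
  (foldl_turn b _ _ (init_consistent n m)).1

theorem card_avail_runTurns (t : ℕ) : #(runTurns b a t).avail = m - t := by
  rw [runTurns, (foldl_turn b _ _ (init_consistent n m)).2]
  simp [init]

theorem avail_runTurns_nonempty (t : Fin m) : (runTurns b a t).avail.Nonempty := by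
  rw [← card_pos, card_avail_runTurns]
  exact Nat.sub_pos_of_lt t.isLt

theorem avail_runTurns_of_le {t : ℕ} (ht : m ≤ t) : (runTurns b a t).avail = ∅ := by
  rw [← card_eq_zero, card_avail_runTurns, Nat.sub_eq_zero_of_le ht]

theorem runTurns_of_le {t : ℕ} (ht : m ≤ t) : runTurns b a t = runTurns b a m := by
  induction t, ht using Nat.le_induction with
  | base => rfl
  | succ t ht ih =>
    rw [runTurns_succ, turn, dif_neg (by simp [avail_runTurns_of_le b a ht]), ih]

/-- The good that changes hands in turn `t`. The goods are exhausted after `m` turns, so that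
every turn `t : Fin m` has one. -/
noncomputable def pick (t : Fin m) : Fin m :=
  favorite (b (a t)) (runTurns b a t).avail (avail_runTurns_nonempty b a t)

theorem runTurns_succ_eq_pick (t : Fin m) :
    runTurns b a (t + 1) =
      { avail := (runTurns b a t).avail.erase (pick b a t)
        bundle := Function.update (runTurns b a t).bundle (a t)
          (insert (pick b a t) ((runTurns b a t).bundle (a t))) } := by
  rw [runTurns_succ, turn, dif_pos (avail_runTurns_nonempty b a t), pick]

theorem mem_avail_runTurns {t : ℕ} (ht : t ≤ m) (g : Fin m) :
    g ∈ (runTurns b a t).avail ↔ ∀ s : Fin m, (s : ℕ) < t → pick b a s ≠ g := by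
  induction t with
  | zero => simp [runTurns, init]
  | succ t ih =>
    rw [runTurns_succ_eq_pick b a ⟨t, ht⟩, mem_erase, ih (Nat.le_of_succ_le ht)]
    constructor
    · rintro ⟨hne, h⟩ s hs
      rcases Nat.lt_succ_iff_lt_or_eq.mp hs with hs | rfl
      exacts [h s hs, hne.symm]
    · exact fun h => ⟨(h ⟨t, ht⟩ t.lt_succ_self).symm, fun s hs => h s (Nat.lt_succ_of_lt hs)⟩

theorem mem_bundle_runTurns {t : ℕ} (ht : t ≤ m) (i : Fin n) (g : Fin m) :
    g ∈ (runTurns b a t).bundle i ↔ ∃ s : Fin m, (s : ℕ) < t ∧ a s = i ∧ pick b a s = g := by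
  induction t with
  | zero => simp [runTurns, init]
  | succ t ih =>
    have hstep : g ∈ (runTurns b a (t + 1)).bundle i ↔
        (a t = i ∧ pick b a ⟨t, ht⟩ = g) ∨ g ∈ (runTurns b a t).bundle i := by
      rw [runTurns_succ_eq_pick b a ⟨t, ht⟩]
      by_cases hi : a t = i
      · simp [← hi, eq_comm]
      · simp [hi, Ne.symm hi]
    rw [hstep, ih (Nat.le_of_succ_le ht)]
    constructor
    · rintro (h | ⟨s, hs, h⟩)
      exacts [⟨⟨t, ht⟩, t.lt_succ_self, h⟩, ⟨s, Nat.lt_succ_of_lt hs, h⟩]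
    · rintro ⟨s, hs, h⟩
      rcases Nat.lt_succ_iff_lt_or_eq.mp hs with hs | rfl
      exacts [.inr ⟨s, hs, h⟩, .inl h]

theorem pick_injective : Function.Injective (pick b a) :=
  .of_lt_imp_ne fun s t hst =>
    (mem_avail_runTurns b a t.isLt.le _).mp
      (favorite_mem _ _ (avail_runTurns_nonempty b a t)) s hst

/-- The permutation that maps every turn to the good picked in it. -/
noncomputable def pickOrder : Equiv.Perm (Fin m) :=
  Equiv.ofBijective (pick b a) (Finite.injective_iff_bijective.mp (pick_injective b a))

theorem bid_pickOrder_le {t p : Fin m} (htp : t ≤ p) :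
    b (a t) (pickOrder b a p) ≤ b (a t) (pickOrder b a t) := by
  have hmem : pick b a p ∈ (runTurns b a t).avail :=
    (mem_avail_runTurns b a t.isLt.le _).mpr fun s hs =>
      (pick_injective b a).ne (Fin.ne_of_lt (lt_of_lt_of_le hs htp))
  exact le_favorite _ (avail_runTurns_nonempty b a t) hmem

/-- The turns of agent `i` among the `m` turns in which a good is picked. -/
def turnsOf (m : ℕ) {n : ℕ} (a : ℕ → Fin n) (i : Fin n) : Finset (Fin m) :=
  univ.filter fun t => a t = i

theorem bundle_runTurns (i : Fin n) :
    (runTurns b a m).bundle i = (turnsOf m a i).map (pickOrder b a).toEmbedding := by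
  ext g
  simp only [mem_bundle_runTurns b a le_rfl, Fin.is_lt, true_and, turnsOf, mem_map, mem_filter,
    mem_univ]
  rfl

theorem val_bundle_runTurns (v : AdditiveValuation m) (i : Fin n) :
    v.val ((runTurns b a m).bundle i) = ∑ t ∈ turnsOf m a i, v.val {pickOrder b a t} := by
  rw [bundle_runTurns, v.val_eq_sum, sum_map]
  rfl

/-- The mechanism that lets the agents pick goods in the order given by `a`, each turn following
the rule of Round-Robin; the goods are exhausted after `m` turns. -/
noncomputable def sequentialPicking : Mechanism n m := fun b =>
  { bundle := (runTurns b a m).bundle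
    disjoint := (runTurns_consistent b a m).1
    cover := fun g =>
      ((runTurns_consistent b a m).2.2 g).resolve_left (by simp [avail_runTurns_of_le]) }

end PickingSequence

/-- The profile in which every agent bids her true values. -/
def truthfulBids {n m : ℕ} (v : Fin n → AdditiveValuation m) : BidProfile n m :=
  fun i g => ⟨(v i).val {g}, (v i).nonneg g⟩

/-- A bid vector that ranks the goods in the order `σ 0, σ 1, …`, without ties. -/
def rankBid {m : ℕ} (σ : Equiv.Perm (Fin m)) : Bid m := fun g => ((σ.symm g).rev : ℕ)

theorem rankBid_le_rankBid_iff {m : ℕ} (σ : Equiv.Perm (Fin m)) {g h : Fin m} :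
    rankBid σ g ≤ rankBid σ h ↔ σ.symm h ≤ σ.symm g := by
  rw [rankBid, rankBid, Nat.cast_le, ← Fin.le_def, Fin.rev_le_rev]

theorem symm_pickOrder_le_of_eq_rankBid {n m : ℕ} {b : BidProfile n m} {a : ℕ → Fin n}
    {σ : Equiv.Perm (Fin m)} {t p : Fin m} (hb : b (a t) = rankBid σ) (htp : t ≤ p) :
    σ.symm (pickOrder b a t) ≤ σ.symm (pickOrder b a p) := by
  rw [← rankBid_le_rankBid_iff, ← hb]
  exact bid_pickOrder_le b a htp

theorem pickOrder_rankBid {n m : ℕ} (σ : Equiv.Perm (Fin m)) (a : ℕ → Fin n) :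
    pickOrder (fun _ => rankBid σ) a = σ := by
  have hmono : StrictMono ((pickOrder (fun _ => rankBid σ) a).trans σ.symm) :=
    Monotone.strictMono_of_injective (fun _ _ => symm_pickOrder_le_of_eq_rankBid rfl)
      (Equiv.injective _)
  have hid := (hmono.range_inj strictMono_id).mp (by simp only [Equiv.range_eq_univ, Set.range_id])
  ext t : 1
  exact (Equiv.symm_apply_eq σ).mp (congrFun hid t)

/-- The picking sequence `0, 1, …, n - 1, 0, 1, …` of Round-Robin. -/
def cyclicOrder {n : ℕ} (hn : 0 < n) (t : ℕ) : Fin n := ⟨t % n, Nat.mod_lt t hn⟩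

theorem map_cyclicOrder_range {n : ℕ} (hn : 0 < n) (k : ℕ) :
    (List.range n).map (fun j => cyclicOrder hn (k * n + j)) = List.finRange n :=
  List.ext_getElem (by simp) fun j _ hj => Fin.ext <| by
    simp [cyclicOrder, Nat.mod_eq_of_lt (List.length_finRange ▸ hj)]

theorem iterate_round_eq_runTurns {n m : ℕ} (hn : 0 < n) (b : BidProfile n m) (k : ℕ) :
    (round b)^[k] (init n m) = runTurns b (cyclicOrder hn) (k * n) := by
  induction k with
  | zero => simp [runTurns]
  | succ k ih =>
    rw [Function.iterate_succ_apply', ih, round, ← map_cyclicOrder_range hn k, Nat.succ_mul,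
      runTurns, runTurns, List.range_add, List.map_append, List.foldl_append, List.map_map]
    rfl

theorem final_eq_runTurns {n m : ℕ} (hn : 0 < n) (b : BidProfile n m) :
    final b = runTurns b (cyclicOrder hn) m := by
  have hle : (m : ℚ) ≤ ⌈(m : ℚ) / n⌉₊ * n :=
    (div_le_iff₀ (Nat.cast_pos.mpr hn)).mp (Nat.le_ceil _)
  rw [final, iterate_round_eq_runTurns hn, runTurns_of_le]
  exact_mod_cast hle

theorem roundRobin_eq_sequentialPicking {n m : ℕ} (hn : 0 < n) :
    (roundRobin hn : Mechanism n m) = sequentialPicking (cyclicOrder hn) := by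
  funext b
  simp only [roundRobin, sequentialPicking, final_eq_runTurns hn]

end RoundRobin

end FairDivision

open FairDivision RoundRobin in
theorem theoremA3_general {n m : ℕ} (a : ℕ → Fin n) (v : Fin n → AdditiveValuation m) :
    ∃ b : BidProfile n m, IsPNE (sequentialPicking a) v b := by
  let σ := pickOrder (truthfulBids v) a
  refine ⟨fun _ => rankBid σ, fun i b' => ?_⟩
  let b : BidProfile n m := Function.update (fun _ => rankBid σ) i b'
  let π := pickOrder b a
  let τ : Equiv.Perm (Fin m) := π.trans σ.symm
  have hτ : ∀ t ∉ turnsOf m a i, τ t ≤ t := by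
    intro t ht
    have hb : b (a t) = rankBid σ := Function.update_of_ne (by simpa [turnsOf] using ht) _ _
    exact perm_apply_le_of_forall_le τ fun p => symm_pickOrder_le_of_eq_rankBid hb
  have hσ : ∀ t ∈ turnsOf m a i, ∀ p, t ≤ p → (v i).val {σ p} ≤ (v i).val {σ t} := by
    intro t ht p htp
    obtain rfl : a t = i := by simpa [turnsOf] using ht
    exact bid_pickOrder_le (truthfulBids v) a htp
  calc (v i).val ((sequentialPicking a _).bundle i)
      = ∑ t ∈ turnsOf m a i, (v i).val {σ (τ t)} := by
        simp [sequentialPicking, val_bundle_runTurns, τ, π, b]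
    _ ≤ ∑ t ∈ turnsOf m a i, (v i).val {σ t} :=
        sum_comp_perm_le_sum τ _ (fun t => (v i).val {σ t}) hτ hσ
    _ = (v i).val ((sequentialPicking a _).bundle i) := by
        simp [sequentialPicking, val_bundle_runTurns, pickOrder_rankBid]

theorem theoremA3 (n m : ℕ) (hn : 0 < n) (v : Fin n → FairDivision.AdditiveValuation m) :
    ∃ b : FairDivision.BidProfile n m,
      FairDivision.IsPNE (FairDivision.roundRobin hn) v b := by
  rw [FairDivision.RoundRobin.roundRobin_eq_sequentialPicking hn]
  exact theoremA3_general _ v
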